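/- Let $\lambda_1,\dots,\lambda_n,\tilde\lambda_1,\dots,\tilde\lambda_n\in\mathbb C^2$ be spinors of $n$ massless particles in four dimensions, with momenta $k_a^\mu=\tfrac12\langle a|\gamma^\mu|a]$ satisfying $\sum_a k_a=0$. Write $\langle ab\rangle$, $[ab]$ for the antisymmetric spinor brackets, normalized so that $\langle x|\gamma^\mu|y]\langle z|\gamma_\mu|w]=2\langle xz\rangle[wy]$, and $s_{ab}=2k_a\cdot k_b=-\langle ab\rangle[ab]$. Let $|p\rangle$, $|q]$ be reference spinors with $\langle ap\rangle\ne0$ and $[aq]\neq 0$ for all $a$. A solution of the scattering equations is a tuple $\sigma\in\mathbb C^n$ of pairwise distinct points with $\sum_{b\ne a}s_{ab}/\sigma_{ab}=0$ for all $a$, where $\sigma_{ab}=\sigma_a-\sigma_b$. Define the $n\times n$ discriminant matrices $$(\mathfrak C_-)_{ab}=\frac{\langle ab\rangle}{\sigma_{ab}}\ (a\ne b),\quad (\mathfrak C_-)_{aa}=-\sum_{c\ne a}\frac{\langle ac\rangle[cq]}{\sigma_{ac}[aq]},\qquad (\mathfrak C_+)_{ab}=\frac{[ab]}{\sigma_{ab}}\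 (a\ne b),\quad (\mathfrak C_+)_{aa}=-\sum_{c\ne a}\frac{[ac]\langle cp\rangle}{\sigma_{ac}\langle ap\rangle},$$ and, for $m\in\mathbb Z$, let $\boldsymbol P_\pm(n-3,m)$ be the set of solutions $\sigma$ with $\operatorname{rank}\mathfrak C_\pm(\sigma)=m+1$. Given a helicity assignment, put $\epsilon_a(-)=\langle a|\gamma^\mu|q]/(\sqrt2[qa])$, $\epsilon_a(+)=\langle p|\gamma^\mu|a]/(\sqrt2\langle pa\rangle)$, and let $\Psi=\begin{pmatrix}A&-C^T\\C&B\end{pmatrix}$ with $$A_{ab}=\frac{s_{ab}}{\sigma_{ab}},\quad B_{ab}=\frac{\epsilon_a\cdot\epsilon_b}{\sigma_{ab}},\quad C_{ab}=-\frac{\sqrt2\,\epsilon_a\cdot k_b}{\sigma_{ab}}\quad(a\neq b),\qquad A_{aa}=B_{aa}=0,\quad C_{aa}=\sum_{c\neq a}\frac{\sqrt2\,\epsilon_a\cdot k_c}{\sigma_{ac}}.$$ For $1\le i<j\le n$ let $\mathrm{Pf}'(\Psi)=\frac{(-1)^{i+j}}{\sigma_{ij}}\mathrm{Pf}(\Psi^{ij}_{ij})$,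 where $\Psi^{ij}_{ij}$ is $\Psi$ with the $i$-th and $j$-th rows and columns deleted. The configuration is N$^k$MHV if exactly $k+2$ particles have negative helicity. Then: (0) If at least one $\langle ab\rangle$ is nonzero and at least one $[ab]$ is nonzero, the solution set is $\bigcup_{m=0}^{n-4}\boldsymbol P_-(n-3,m)=\bigcup_{m=0}^{n-4}\boldsymbol P_+(n-3,m)$; for each sign the classes with different $m$ are disjoint. (1) At any N$^k$MHV helicity configuration, a solution $\sigma$ with $\mathrm{Pf}'(\Psi)\neq0$ (for any choice of $i<j$) lies in $\boldsymbol P_-(n-3,k)$. (2) At any N$^{n-k-4}$MHV helicity configuration, a solution $\sigma$ with $\mathrm{Pf}'(\Psi)\neq0$ (for any choice of $i<j$) lies in $\boldsymbol P_+(n-3,k)$. (3) Statements (1) and (2) also hold with $\mathrm{Pf}'(\Psi)$ replaced by the Yang–Mills integrand $(-\sqrt2)^n\,\mathrm{Pf}'(\Psi)/(\sigma_{12}\sigma_{23}\cdots\sigma_{n1})$, the gravity integrand $2^n\,\mathrm{Pf}'(\Psi)^2$, or the single-trace Einstein–Yang–Mills integrand $(-\sqrt2)^{n+s}\,\mathrm{Pf}(\Psi_{\mathsf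 h})\,\mathrm{Pf}'(\Psi)/(\sigma_{g_1g_2}\cdots\sigma_{g_rg_1})$ for gluons $g_1,\dots,g_r$ and $s=n-r$ gravitons, where $\Psi_{\mathsf h}$ is the $2s\times2s$ submatrix of $\Psi$ whose rows and columns are those labelled by gravitons, in both blocks. -/

import Mathlib

namespace CHY

noncomputable section

/-! ### Spinor-helicity kinematics in four dimensions (complexified) -/

/-- Two-component spinors. Angle spinors `|a⟩` and square spinors `|a]` both live here. -/
abbrev Spinor := Fin 2 → ℂ

/-- Complexified four-vectors. -/
abbrev FourVec := Fin 4 → ℂ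

/-- The angle bracket `⟨x y⟩`. -/
def angle (x y : Spinor) : ℂ := x 0 * y 1 - x 1 * y 0

/-- The square bracket `[x y]`, with the relative sign for which `2 k_a · k_b = -⟨ab⟩[ab]`. -/
def square (x y : Spinor) : ℂ := x 1 * y 0 - x 0 * y 1

/-- The matrices `σ^μ = (1, σ₁, σ₂, σ₃)`. -/
def pauli : Fin 4 → Matrix (Fin 2) (Fin 2) ℂ :=
  ![1, !![0, 1; 1, 0], !![0, -Complex.I; Complex.I, 0], !![1, 0; 0, -1]]

/-- The four-vector `⟨x|γ^μ|y]`. -/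
def sandwich (x y : Spinor) : FourVec := fun μ => x ⬝ᵥ (pauli μ).mulVec y

/-- The (complex bilinear) Minkowski product of signature `(+,-,-,-)`. -/
def mdot (u v : FourVec) : ℂ := u 0 * v 0 - u 1 * v 1 - u 2 * v 2 - u 3 * v 3

/-- The Fierz identity `⟨x|γ^μ|y] ⟨z|γ_μ|w] = 2 ⟨xz⟩[wy]`, fixing all sign conventions. -/
theorem mdot_sandwich (x y z w : Spinor) :
    mdot (sandwich x y) (sandwich z w) = 2 * angle x z * square w y := by
  simp only [mdot, sandwich, pauli, angle, square, Matrix.mulVec, dotProduct, Fin.sum_univ_two,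
    Matrix.cons_val, Matrix.of_apply, Matrix.cons_val', Matrix.one_apply]
  simp
  ring_nf
  simp only [Complex.I_sq]
  ring

section Particles

variable {n : ℕ} (lam lamT : Fin n → Spinor) (p q : Spinor)

/-- The null momentum `k_a^μ = ½ ⟨a|γ^μ|a]`. -/
def momentum (a : Fin n) : FourVec := (1 / 2 : ℂ) • sandwich (lam a) (lamT a)

/-- The Mandelstam variable `s_ab = 2 k_a · k_b`. -/
def mandelstam (a b : Fin n) : ℂ := 2 * mdot (momentum lam lamT a) (momentum lam lamT b)

/-- A solution of the scattering equations: pairwise distinct punctures with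
`∑_{b ≠ a} s_ab / (σ_a - σ_b) = 0` for every `a`. -/
def IsSolution (σ : Fin n → ℂ) : Prop :=
  Function.Injective σ ∧
    ∀ a, ∑ b ∈ Finset.univ.erase a, mandelstam lam lamT a b / (σ a - σ b) = 0

/-! ### Discriminant matrices and the two families of classes -/

/-- The discriminant matrix `𝔆₋`. -/
def discMinus (σ : Fin n → ℂ) : Matrix (Fin n) (Fin n) ℂ := Matrix.of fun a b =>
  if a = b then
    -∑ c ∈ Finset.univ.erase a,
      angle (lam a) (lam c) * square (lamT c) q / ((σ a - σ c) * square (lamT a) q)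
  else angle (lam a) (lam b) / (σ a - σ b)

/-- The discriminant matrix `𝔆₊`. -/
def discPlus (σ : Fin n → ℂ) : Matrix (Fin n) (Fin n) ℂ := Matrix.of fun a b =>
  if a = b then
    -∑ c ∈ Finset.univ.erase a,
      square (lamT a) (lamT c) * angle (lam c) p / ((σ a - σ c) * angle (lam a) p)
  else square (lamT a) (lamT b) / (σ a - σ b)

/-- The class `P₋(n-3, m)`: solutions with `rank 𝔆₋ = m + 1`. -/
def PMinus (m : ℤ) : Set (Fin n → ℂ) :=
  {σ | IsSolution lam lamT σ ∧ ((discMinus lam lamT q σ).rank : ℤ) = m + 1}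

/-- The class `P₊(n-3, m)`: solutions with `rank 𝔆₊ = m + 1`. -/
def PPlus (m : ℤ) : Set (Fin n → ℂ) :=
  {σ | IsSolution lam lamT σ ∧ ((discPlus lam lamT p σ).rank : ℤ) = m + 1}

/-! ### Helicities, polarizations and the matrix `Ψ` -/

/-- A helicity configuration is given by the set `neg` of negative-helicity particles; it is
N^kMHV when there are `k + 2` of them. -/
def IsNkMHV (neg : Finset (Fin n)) (k : ℤ) : Prop := (neg.card : ℤ) = k + 2

/-- The polarization vectors `ε_a(-) = ⟨a|γ^μ|q] / (√2 [qa])`, `ε_a(+) = ⟨p|γ^μ|a] / (√2 ⟨pa⟩)`. -/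
def polarization (neg : Finset (Fin n)) (a : Fin n) : FourVec :=
  if a ∈ neg then
    (1 / ((Real.sqrt 2 : ℂ) * square q (lamT a))) • sandwich (lam a) q
  else
    (1 / ((Real.sqrt 2 : ℂ) * angle p (lam a))) • sandwich p (lamT a)

/-- The block `A` of `Ψ`. -/
def blockA (σ : Fin n → ℂ) : Matrix (Fin n) (Fin n) ℂ := Matrix.of fun a b =>
  if a = b then 0 else mandelstam lam lamT a b / (σ a - σ b)

/-- The block `B` of `Ψ`. -/
def blockB (neg : Finset (Fin n)) (σ : Fin n → ℂ) : Matrix (Fin n) (Fin n) ℂ :=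
  Matrix.of fun a b =>
    if a = b then 0
    else mdot (polarization lam lamT p q neg a) (polarization lam lamT p q neg b) / (σ a - σ b)

/-- The block `C` of `Ψ`. -/
def blockC (neg : Finset (Fin n)) (σ : Fin n → ℂ) : Matrix (Fin n) (Fin n) ℂ :=
  Matrix.of fun a b =>
    if a = b then
      ∑ c ∈ Finset.univ.erase a,
        (Real.sqrt 2 : ℂ) * mdot (polarization lam lamT p q neg a) (momentum lam lamT c)
          / (σ a - σ c)
    else
      -((Real.sqrt 2 : ℂ) * mdot (polarization lam lamT p q neg a) (momentum lam lamT b)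
          / (σ a - σ b))

/-- The `2n × 2n` matrix `Ψ = (A, -Cᵀ; C, B)`, with rows and columns ordered as
`1, …, n` (upper block) followed by `1, …, n` (lower block). -/
def Psi (neg : Finset (Fin n)) (σ : Fin n → ℂ) : Matrix (Fin (n + n)) (Fin (n + n)) ℂ :=
  (Matrix.fromBlocks (blockA lam lamT σ) (-(blockC lam lamT p q neg σ).transpose)
    (blockC lam lamT p q neg σ) (blockB lam lamT p q neg σ)).submatrix
      finSumFinEquiv.symm finSumFinEquiv.symm

end Particles

/-! ### Pfaffians -/

/-- The Pfaffian of a `2m × 2m` (antisymmetric) matrix,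
`1/(2^m m!) ∑_π sgn(π) ∏_{t < m} M_{π(2t), π(2t+1)}`. -/
def pfaffian {m : ℕ} (M : Matrix (Fin (2 * m)) (Fin (2 * m)) ℂ) : ℂ :=
  (1 / ((2 : ℂ) ^ m * (m.factorial : ℂ))) *
    ∑ π : Equiv.Perm (Fin (2 * m)), ((Equiv.Perm.sign π : ℤ) : ℂ) *
      ∏ t : Fin m, M (π ⟨2 * (t : ℕ), by omega⟩) (π ⟨2 * (t : ℕ) + 1, by omega⟩)

/-- The Pfaffian of the principal submatrix of `M` with rows and columns in `S`, taken in
increasing order (zero if `S` has odd size). -/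
def pfaffianOn {N : ℕ} (M : Matrix (Fin N) (Fin N) ℂ) (S : Finset (Fin N)) : ℂ :=
  if h : S.card = 2 * (S.card / 2) then
    pfaffian (M.submatrix (S.orderEmbOfFin h) (S.orderEmbOfFin h))
  else 0

section Integrands

variable {n : ℕ} (lam lamT : Fin n → Spinor) (p q : Spinor)

/-- The reduced Pfaffian `Pf′(Ψ) = (-1)^{i+j} / σ_ij · Pf(Ψ_ij^ij)`: rows and columns `i`, `j`
of the upper block are deleted. -/
def reducedPf (neg : Finset (Fin n)) (σ : Fin n → ℂ) (i j : Fin n) : ℂ :=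
  (-1) ^ ((i : ℕ) + (j : ℕ)) / (σ i - σ j) *
    pfaffianOn (Psi lam lamT p q neg σ)
      (Finset.univ \ {Fin.castAdd n i, Fin.castAdd n j})

/-- `Pf(Ψ_h)` for a set `hs` of gravitons: `Ψ_h` consists of the rows and columns of `Ψ`
labelled by gravitons, in both blocks. -/
def pfPsiH (neg : Finset (Fin n)) (σ : Fin n → ℂ) (hs : Finset (Fin n)) : ℂ :=
  pfaffianOn (Psi lam lamT p q neg σ)
    (hs.map (Fin.castAddEmb n) ∪ hs.map (Fin.natAddEmb n))

/-- The Yang-Mills integrand `(-√2)^n Pf′(Ψ) / (σ₁₂ σ₂₃ ⋯ σ_{n1})`. -/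
def integrandYM (neg : Finset (Fin n)) (σ : Fin n → ℂ) (i j : Fin n) : ℂ :=
  (-(Real.sqrt 2 : ℂ)) ^ n * reducedPf lam lamT p q neg σ i j /
    ∏ a : Fin n, (σ a - σ (finRotate n a))

/-- The pure-gravity integrand `2^n Pf′(Ψ) Pf′(Ψ)`. -/
def integrandGravity (neg : Finset (Fin n)) (σ : Fin n → ℂ) (i j : Fin n) : ℂ :=
  2 ^ n * (reducedPf lam lamT p q neg σ i j * reducedPf lam lamT p q neg σ i j)

/-- The single-trace Einstein-Yang-Mills integrand
`(-√2)^{n+s} Pf(Ψ_h) Pf′(Ψ) / (σ_{g₁g₂} ⋯ σ_{g_r g₁})`; the gluons are `g₁, …, g_r` in colour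
order and the `s` remaining particles are the gravitons. -/
def integrandEYM (neg : Finset (Fin n)) (σ : Fin n → ℂ) {r : ℕ} (g : Fin r ↪ Fin n)
    (i j : Fin n) : ℂ :=
  (-(Real.sqrt 2 : ℂ)) ^ (n + (Finset.univ \ Finset.univ.map g).card) *
    pfPsiH lam lamT p q neg σ (Finset.univ \ Finset.univ.map g) *
    reducedPf lam lamT p q neg σ i j /
    ∏ t : Fin r, (σ (g t) - σ (g (finRotate r t)))

end Integrands

end

end CHY

namespace CHY

/-! ### Pfaffians and isotropic subspaces -/

theorem prod_pairs {m : ℕ} (h : Fin (2 * m) → ℂ) :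
    ∏ s, h s = ∏ t : Fin m, h ⟨2 * (t : ℕ), by omega⟩ * h ⟨2 * (t : ℕ) + 1, by omega⟩ := by
  induction m with
  | zero => simp
  | succ m ih =>
    rw [Fin.prod_univ_castSucc (n := m)]
    change ∏ s : Fin (2 * m + 1 + 1), h s = _
    rw [Fin.prod_univ_castSucc, Fin.prod_univ_castSucc, ih (fun s => h s.castSucc.castSucc),
      mul_assoc]
    rfl

/-- The column index attached to position `s` by a choice `f` of one index pair for each `t`. -/
def pairIndex {m : ℕ} {ι : Type*} (f : Fin m → ι × ι) (s : Fin (2 * m)) : ι :=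
  if (s : ℕ) % 2 = 0 then (f ⟨s / 2, by omega⟩).1 else (f ⟨s / 2, by omega⟩).2

theorem pairIndex_even {m : ℕ} {ι : Type*} (f : Fin m → ι × ι) (t : Fin m) :
    pairIndex f ⟨2 * (t : ℕ), by omega⟩ = (f t).1 := by
  simp [pairIndex]

theorem pairIndex_odd {m : ℕ} {ι : Type*} (f : Fin m → ι × ι) (t : Fin m) :
    pairIndex f ⟨2 * (t : ℕ) + 1, by omega⟩ = (f t).2 := by
  have h : (2 * (t : ℕ) + 1) / 2 = t := by omega
  simp [pairIndex, h, Nat.add_mod]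

/-- Expanding every entry of the congruence over pairs of summation indices leaves, for each choice
of pairs, a signed sum over permutations of entries of `B`: the determinant of the selected columns.
-/
theorem pfaffian_conj_expand {m : ℕ} (B M : Matrix (Fin (2 * m)) (Fin (2 * m)) ℂ) :
    pfaffian (B * M * B.transpose) = (1 / ((2 : ℂ) ^ m * (m.factorial : ℂ))) *
      ∑ f : Fin m → Fin (2 * m) × Fin (2 * m),
        (∏ t, M (f t).1 (f t).2) * (B.submatrix id (pairIndex f)).det := by
  unfold pfaffian
  congr 1
  have key : ∀ x y, (B * M * B.transpose) x y =
      ∑ kl : Fin (2 * m) × Fin (2 * m), M kl.1 kl.2 * (B x kl.1 * B y kl.2) := by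
    intro x y
    rw [Fintype.sum_prod_type_right]
    simp only [Matrix.mul_apply, Matrix.transpose_apply, Finset.sum_mul]
    exact Finset.sum_congr rfl fun _ _ => Finset.sum_congr rfl fun _ _ => by ring
  simp only [key, Finset.prod_univ_sum, Fintype.piFinset_univ, Matrix.det_apply', Finset.mul_sum]
  rw [Finset.sum_comm]
  refine Finset.sum_congr rfl fun f _ => Finset.sum_congr rfl fun π _ => ?_
  rw [prod_pairs]
  simp only [Matrix.submatrix_apply, id, pairIndex_even, pairIndex_odd, Finset.prod_mul_distrib]
  ring

/-- In the expansion `B` enters only through determinants of selected columns, and selecting columns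
of `B` is multiplying `B` by selected columns of the identity. Comparison with the case `B = 1` then
extracts `B.det` term by term. -/
theorem pfaffian_conj {m : ℕ} (B M : Matrix (Fin (2 * m)) (Fin (2 * m)) ℂ) :
    pfaffian (B * M * B.transpose) = B.det * pfaffian M := by
  have h1 := pfaffian_conj_expand 1 M
  rw [Matrix.transpose_one, Matrix.one_mul, Matrix.mul_one] at h1
  rw [pfaffian_conj_expand, h1, mul_left_comm]
  congr 1
  rw [Finset.mul_sum]
  refine Finset.sum_congr rfl fun f _ => ?_
  have : B.submatrix id (pairIndex f) =
      B * (1 : Matrix (Fin (2 * m)) (Fin (2 * m)) ℂ).submatrix id (pairIndex f) := by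
    ext x y
    simp [Matrix.mul_apply, Matrix.one_apply]
  rw [this, Matrix.det_mul]
  ring

theorem pfaffian_eq_zero_of_row {m : ℕ} (M : Matrix (Fin (2 * m)) (Fin (2 * m)) ℂ)
    (s : Fin (2 * m)) (hrow : ∀ x, M s x = 0) (hcol : ∀ x, M x s = 0) : pfaffian M = 0 := by
  unfold pfaffian
  refine mul_eq_zero_of_right _ (Finset.sum_eq_zero fun π _ => mul_eq_zero_of_right _ ?_)
  obtain ⟨u, rfl⟩ := π.surjective s
  -- Position `u` of the permuted list belongs to pair `u / 2`; its parity decides whether a row or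
  -- a column entry vanishes.
  refine Finset.prod_eq_zero (Finset.mem_univ (⟨(u : ℕ) / 2, by omega⟩ : Fin m)) ?_
  rcases Nat.mod_two_eq_zero_or_one u with h | h
  · have : (⟨2 * ((u : ℕ) / 2), by omega⟩ : Fin (2 * m)) = u := Fin.ext (by simp; omega)
    simp only [this, hrow]
  · have : (⟨2 * ((u : ℕ) / 2) + 1, by omega⟩ : Fin (2 * m)) = u := Fin.ext (by simp; omega)
    simp only [this, hcol]

/-- Congruence by the identity with row `s` replaced by the null vector clears row and column `s`,
while its determinant `v s` is nonzero. -/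
theorem pfaffian_eq_zero_of_mulVec_eq_zero {m : ℕ} (M : Matrix (Fin (2 * m)) (Fin (2 * m)) ℂ)
    (hM : M.transpose = -M) (v : Fin (2 * m) → ℂ) (hv : v ≠ 0) (h : M.mulVec v = 0) :
    pfaffian M = 0 := by
  obtain ⟨s, hs⟩ := Function.ne_iff.1 hv
  set B := (1 : Matrix (Fin (2 * m)) (Fin (2 * m)) ℂ).updateRow s v with hB
  have hdet : B.det = v s := by
    rw [hB, ← Matrix.cramer_transpose_apply, Matrix.transpose_one, Matrix.cramer_one]
    rfl
  have hcol : ∀ x, (B * M * B.transpose) x s = 0 := by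
    intro x
    have : ∀ y, (M * B.transpose) y s = 0 := by
      intro y
      have := congrFun h y
      simpa [Matrix.mul_apply, hB, Matrix.mulVec, dotProduct] using this
    rw [Matrix.mul_assoc, Matrix.mul_apply]
    simp [this]
  have hskew : (B * M * B.transpose).transpose = -(B * M * B.transpose) := by
    simp [Matrix.transpose_mul, hM, Matrix.mul_assoc]
  have hrow : ∀ x, (B * M * B.transpose) s x = 0 := by
    intro x
    have := congrFun (congrFun hskew x) s
    rw [Matrix.transpose_apply, Matrix.neg_apply, hcol x, neg_zero] at this
    exact this
  have h0 := pfaffian_eq_zero_of_row _ s hrow hcol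
  rw [pfaffian_conj, hdet] at h0
  exact (mul_eq_zero.1 h0).resolve_left hs

/-- An invertible `M` would embed the isotropic space into its own annihilator, whose dimension is
the codimension of that space. -/
theorem exists_mulVec_eq_zero_of_isotropic {κ E : Type*} [Fintype κ] [DecidableEq κ]
    [AddCommGroup E] [Module ℂ E] (M : Matrix κ κ ℂ) (Φ : E →ₗ[ℂ] (κ → ℂ))
    (hΦ : Function.Injective Φ) (hiso : ∀ x y, Φ x ⬝ᵥ M.mulVec (Φ y) = 0)
    (hdim : Fintype.card κ < 2 * Module.finrank ℂ E) : ∃ v ≠ 0, M.mulVec v = 0 := by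
  by_contra! hinj
  have hM : Function.Injective M.mulVecLin := by
    rw [← LinearMap.ker_eq_bot, LinearMap.ker_eq_bot']
    intro v hv
    by_contra hne
    exact hinj v hne hv
  let F : E →ₗ[ℂ] Module.Dual ℂ (κ → ℂ) :=
    (dotProductEquiv ℂ κ).toLinearMap ∘ₗ M.mulVecLin ∘ₗ Φ
  have hF : Function.Injective F := (dotProductEquiv ℂ κ).injective.comp (hM.comp hΦ)
  have hle : LinearMap.range F ≤ (LinearMap.range Φ).dualAnnihilator := by
    rintro _ ⟨y, rfl⟩
    rw [Submodule.mem_dualAnnihilator]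
    rintro _ ⟨x, rfl⟩
    change M.mulVec (Φ y) ⬝ᵥ Φ x = 0
    rw [dotProduct_comm, hiso]
  have h1 := Submodule.finrank_mono hle
  have h2 := Subspace.finrank_add_finrank_dualAnnihilator_eq (LinearMap.range Φ)
  rw [LinearMap.finrank_range_of_inj hF] at h1
  rw [LinearMap.finrank_range_of_inj hΦ, Module.finrank_fintype_fun_eq_card] at h2
  omega

/-- Vectors supported on `S` pair in the same way under `M` and under its principal submatrix, so
isotropy can be checked in the block indexing `ι`, with no reference to the ordering of `S`. -/
theorem finrank_le_of_pfaffianOn_ne_zero {N : ℕ} {ι E : Type*} [Fintype ι]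
    [AddCommGroup E] [Module ℂ E] (e : ι ≃ Fin N) (M : Matrix ι ι ℂ) (hM : M.transpose = -M)
    (S : Finset (Fin N)) (hpf : pfaffianOn (M.submatrix e.symm e.symm) S ≠ 0)
    (Φ : E →ₗ[ℂ] (ι → ℂ)) (hΦ : Function.Injective Φ) (hsupp : ∀ x i, e i ∉ S → Φ x i = 0)
    (hiso : ∀ x y, Φ x ⬝ᵥ M.mulVec (Φ y) = 0) : 2 * Module.finrank ℂ E ≤ S.card := by
  unfold pfaffianOn at hpf
  split_ifs at hpf with h
  swap
  · exact absurd rfl hpf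
  by_contra! hlt
  set o := S.orderEmbOfFin h with ho
  have hsum : ∀ g : ι → ℂ, (∀ i, e i ∉ S → g i = 0) → ∑ s, g (e.symm (o s)) = ∑ i, g i := by
    intro g hg
    have hmap : ∑ x ∈ S, g (e.symm x) = ∑ s, g (e.symm (o s)) := by
      conv_lhs => rw [← Finset.map_orderEmbOfFin_univ S h, Finset.sum_map]
      rfl
    rw [← hmap, ← Equiv.sum_comp e.symm g]
    exact Finset.sum_subset (Finset.subset_univ S) fun x _ hx => hg _ (by simpa using hx)
  let Ψ : E →ₗ[ℂ] (Fin (2 * (S.card / 2)) → ℂ) := LinearMap.funLeft ℂ ℂ (e.symm ∘ o) ∘ₗ Φ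
  have hΨ : Function.Injective Ψ := by
    rw [← LinearMap.ker_eq_bot, LinearMap.ker_eq_bot']
    intro x hx
    apply hΦ
    rw [map_zero]
    ext i
    by_cases hi : e i ∈ S
    · have : e i ∈ Set.range o := by rw [ho, Finset.range_orderEmbOfFin]; exact hi
      obtain ⟨s, hs⟩ := this
      have := congrFun hx s
      simpa [Ψ, LinearMap.funLeft_apply, hs] using this
    · exact hsupp x i hi
  obtain ⟨v, hv, hMv⟩ := exists_mulVec_eq_zero_of_isotropic
    ((M.submatrix e.symm e.symm).submatrix o o) Ψ hΨ (fun x y => by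
      rw [← hiso x y]
      simp only [dotProduct, Matrix.mulVec, Matrix.submatrix_apply, Ψ, LinearMap.comp_apply,
        LinearMap.funLeft_apply, Function.comp_apply]
      rw [← hsum (fun i => Φ x i * ∑ j, M i j * Φ y j) fun i hi => by rw [hsupp x i hi, zero_mul]]
      refine Finset.sum_congr rfl fun s _ => ?_
      rw [hsum (fun j => M (e.symm (o s)) j * Φ y j) fun j hj => by rw [hsupp y j hj, mul_zero]])
    (by rw [Fintype.card_fin]; omega)
  refine hpf (pfaffian_eq_zero_of_mulVec_eq_zero _ ?_ v hv hMv)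
  rw [Matrix.transpose_submatrix, Matrix.transpose_submatrix, hM]
  rfl

/-- A gauge in which part of the polarizations span an isotropic family forces a rank bound. -/
theorem card_le_rank_add_one_of_pfaffianOn_ne_zero {n : ℕ} (A B C S : Matrix (Fin n) (Fin n) ℂ)
    (hA : A.transpose = -A) (hB : B.transpose = -B) (hS : S.transpose = S) (c : ℂ)
    (D H d : Fin n → ℂ) (P : Finset (Fin n))
    (hAS : ∀ a b, A a b = c * (D a * S a b * H b - H a * S a b * D b))
    (hCS : ∀ a ∈ P, ∀ b, C a b = d a * (S a b * D b))
    (hBP : ∀ a ∈ P, ∀ b ∈ P, B a b = 0) {i j : Fin n} (hij : i ≠ j)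
    (hpf : pfaffianOn ((Matrix.fromBlocks A (-C.transpose) C B).submatrix
      finSumFinEquiv.symm finSumFinEquiv.symm)
        (Finset.univ \ {Fin.castAdd n i, Fin.castAdd n j}) ≠ 0) :
    P.card ≤ S.rank + 1 := by
  let SD : Matrix (Fin n) (Fin n) ℂ := S * Matrix.diagonal D
  -- Evaluation at the two deleted indices; its kernel costs at most two dimensions.
  let g : LinearMap.ker SD.mulVecLin →ₗ[ℂ] ℂ × ℂ :=
    ((LinearMap.proj i).prod (LinearMap.proj j)).domRestrict _
  let Y : (P → ℂ) →ₗ[ℂ] (Fin n → ℂ) := Function.ExtendByZero.linearMap ℂ Subtype.val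
  have hY0 : ∀ y a, a ∉ P → Y y a = 0 := fun y a ha =>
    Function.extend_apply' _ _ _ (by rintro ⟨b, rfl⟩; exact ha b.2)
  have hYP : ∀ (y : P → ℂ) (a : P), Y y a = y a := fun y a =>
    Subtype.val_injective.extend_apply _ _ _
  let Φ : (LinearMap.ker g × (P → ℂ)) →ₗ[ℂ] (Fin n ⊕ Fin n → ℂ) :=
    (LinearEquiv.sumArrowLequivProdArrow (Fin n) (Fin n) ℂ ℂ).symm.toLinearMap ∘ₗ
      (((LinearMap.ker SD.mulVecLin).subtype ∘ₗ (LinearMap.ker g).subtype).prodMap Y)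
  have hΦval : ∀ x, Φ x = Sum.elim (x.1 : Fin n → ℂ) (Y x.2) := fun x => by
    ext (a | a) <;> rfl
  have hker : ∀ x : LinearMap.ker g, ∀ a, ∑ b, S a b * (D b * (x : Fin n → ℂ) b) = 0 := by
    intro x a
    have := congrFun (LinearMap.mem_ker.1 x.1.2) a
    simpa only [SD, Matrix.mulVecLin_apply, Matrix.mulVec, dotProduct, Matrix.mul_diagonal, mul_assoc,
      Pi.zero_apply] using this
  have hg : ∀ x : LinearMap.ker g, (x : Fin n → ℂ) i = 0 ∧ (x : Fin n → ℂ) j = 0 := fun x =>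
    Prod.ext_iff.1 (LinearMap.mem_ker.1 x.2)
  have hCx : ∀ (x : LinearMap.ker g) (a : Fin n), a ∈ P → C.mulVec (x : Fin n → ℂ) a = 0 := by
    intro x a ha
    have : C.mulVec (x : Fin n → ℂ) a = d a * ∑ b, S a b * (D b * (x : Fin n → ℂ) b) := by
      simp only [Matrix.mulVec, dotProduct, hCS a ha, Finset.mul_sum]
      exact Finset.sum_congr rfl fun _ _ => by ring
    rw [this, hker, mul_zero]
  have hYC : ∀ y (x : LinearMap.ker g), Y y ⬝ᵥ C.mulVec (x : Fin n → ℂ) = 0 := by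
    intro y x
    refine Finset.sum_eq_zero fun a _ => ?_
    by_cases ha : a ∈ P
    · rw [hCx x a ha, mul_zero]
    · rw [hY0 y a ha, zero_mul]
  have hYB : ∀ y y', Y y ⬝ᵥ B.mulVec (Y y') = 0 := by
    intro y y'
    refine Finset.sum_eq_zero fun a _ => ?_
    by_cases ha : a ∈ P
    · refine mul_eq_zero_of_right _ ?_
      change ∑ b, B a b * Y y' b = 0
      refine Finset.sum_eq_zero fun b _ => ?_
      by_cases hb : b ∈ P
      · rw [hBP a ha b hb, zero_mul]
      · rw [hY0 y' b hb, mul_zero]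
    · rw [hY0 y a ha, zero_mul]
  -- Each half of A = c(D S H - H S D) has S D next to one of the two vectors, after transposing the
  -- symmetric `S`, and S D kills it.
  have hXA : ∀ x x' : LinearMap.ker g,
      (x : Fin n → ℂ) ⬝ᵥ A.mulVec (x' : Fin n → ℂ) = 0 := by
    intro x x'
    have hsym : ∀ a b, S a b = S b a := fun a b => congrFun (congrFun hS b) a
    have h1 : (x : Fin n → ℂ) ⬝ᵥ A.mulVec (x' : Fin n → ℂ) =
        c * (∑ b, H b * (x' : Fin n → ℂ) b * ∑ a, S b a * (D a * (x : Fin n → ℂ) a)) -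
        c * (∑ a, H a * (x : Fin n → ℂ) a * ∑ b, S a b * (D b * (x' : Fin n → ℂ) b)) := by
      simp only [Matrix.mulVec, dotProduct, hAS, Finset.mul_sum]
      rw [Finset.sum_comm (s := Finset.univ) (t := Finset.univ)
        (f := fun b a => c * (H b * (x' : Fin n → ℂ) b * (S b a * (D a * (x : Fin n → ℂ) a)))),
        ← Finset.sum_sub_distrib]
      refine Finset.sum_congr rfl fun a _ => ?_
      rw [← Finset.sum_sub_distrib]
      refine Finset.sum_congr rfl fun b _ => ?_
      rw [hsym b a]
      ring
    rw [h1]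
    simp only [hker, mul_zero, Finset.sum_const_zero, sub_zero]
  have hΦ : Function.Injective Φ := by
    refine (LinearEquiv.sumArrowLequivProdArrow (Fin n) (Fin n) ℂ ℂ).symm.injective.comp ?_
    have hY : Function.Injective Y := by
      intro y y' h
      ext a
      rw [← hYP y a, ← hYP y' a, h]
    exact (Subtype.val_injective.comp Subtype.val_injective).prodMap hY
  have hbound := finrank_le_of_pfaffianOn_ne_zero
    (E := LinearMap.ker g × (P → ℂ)) finSumFinEquiv
    (Matrix.fromBlocks A (-C.transpose) C B)
    (by rw [Matrix.fromBlocks_transpose, hA, hB, Matrix.fromBlocks_neg]; simp) _ hpf Φ hΦ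
    (fun x a ha => by
      rw [hΦval]
      rcases a with a | a
      · change (x.1 : Fin n → ℂ) a = 0
        have : a = i ∨ a = j := by
          simpa [Fin.castAdd_inj, ← or_iff_not_imp_left] using ha
        rcases this with rfl | rfl
        · exact (hg x.1).1
        · exact (hg x.1).2
      · refine absurd ?_ ha
        simp [Fin.ext_iff]
        omega)
    (fun x y => by
      rw [hΦval, hΦval, Matrix.fromBlocks_mulVec, sumElim_dotProduct_sumElim]
      simp only [Sum.elim_comp_inl, Sum.elim_comp_inr, dotProduct_add, hXA, hYC, hYB,
        Matrix.neg_mulVec, dotProduct_neg, Matrix.dotProduct_mulVec, Matrix.vecMul_transpose]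
      rw [dotProduct_comm, hYC]
      simp)
  have hcard : (Finset.univ \ {Fin.castAdd n i, Fin.castAdd n j}).card = n + n - 2 := by
    rw [Finset.card_sdiff_of_subset (Finset.subset_univ _), Finset.card_pair]
    · simp
    · simpa [Fin.castAdd_inj] using hij
  have hSD : SD.rank ≤ S.rank := Matrix.rank_mul_le_left _ _
  have h1 := SD.mulVecLin.finrank_range_add_finrank_ker
  have h2 := g.finrank_range_add_finrank_ker
  have hfree : Module.Free ℂ (LinearMap.ker g) := Module.Free.of_divisionRing ℂ (LinearMap.ker g)
  have h3 := Submodule.finrank_le (LinearMap.range g)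
  rw [Module.finrank_prod, Module.finrank_self] at h3
  rw [Module.finrank_fintype_fun_eq_card, Fintype.card_fin] at h1
  rw [hcard, Module.finrank_prod, Module.finrank_fintype_fun_eq_card, Fintype.card_coe] at hbound
  unfold Matrix.rank at *
  -- Needed because `n + n - 2` is a truncated subtraction. The count is 2(n - rank S - 2 + #P) ≤ 2n
  -- - 2.
  have := i.pos
  omega

/-! ### Commutators with diag(σ) and the bound on the sum of ranks -/

/-- Invariance under diag(σ) gives invariance under every polynomial in it. As the σ are distinct,
interpolating w/y at these nodes carries the nowhere-zero `y` to an arbitrary `w`. -/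
theorem eq_top_of_diagonal_invariant {n : ℕ} {σ : Fin n → ℂ} (hσ : Function.Injective σ)
    (L : Submodule ℂ (Fin n → ℂ)) (hL : ∀ x ∈ L, (fun a => σ a * x a) ∈ L)
    {y : Fin n → ℂ} (hy : y ∈ L) (hy0 : ∀ a, y a ≠ 0) : L = ⊤ := by
  have hpoly : ∀ f : Polynomial ℂ, ∀ x ∈ L, (fun a => f.eval (σ a) * x a) ∈ L := by
    intro f
    induction f using Polynomial.induction_on' with
    | add f g hf hg =>
      intro x hx
      have := L.add_mem (hf x hx) (hg x hx)
      convert this using 1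
      ext a
      simp [add_mul]
    | monomial k c =>
      induction k with
      | zero =>
        intro x hx
        convert L.smul_mem c hx using 1
        ext a
        simp
      | succ k ih =>
        intro x hx
        convert ih _ (hL x hx) using 1
        ext a
        simp [pow_succ, mul_assoc]
  rw [eq_top_iff]
  intro w _
  have := hpoly (Lagrange.interpolate Finset.univ σ fun a => w a / y a) y hy
  convert this using 1
  ext a
  rw [Lagrange.eval_interpolate_at_node _ hσ.injOn (Finset.mem_univ a), div_mul_cancel₀ _ (hy0 a)]

/-- The goal is a chain im S ⊆ im S + span v ⊆ ker T with two strict inclusions. If the second is an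
equality, then T = 0 and two explicit kernel vectors of S suffice instead. -/
theorem rank_add_rank_add_two_le {n : ℕ} [NeZero n] {σ : Fin n → ℂ} (hσ : Function.Injective σ)
    (S T : Matrix (Fin n) (Fin n) ℂ) (hsymm : S.transpose = S) (u v : Fin n → Spinor)
    (hS : ∀ a b, (σ a - σ b) * S a b = square (v a) (v b))
    (hT : ∀ a b, (σ a - σ b) * T a b = angle (u a) (u b))
    (hSu : ∀ s a, ∑ b, S a b * u b s = 0) (hTv : ∀ s a, ∑ b, T a b * v b s = 0)
    (hmom : ∀ s t, ∑ a, u a s * v a t = 0) {p q : Spinor} (hp : ∀ a, angle (u a) p ≠ 0)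
    (hq : ∀ a, square (v a) q ≠ 0) : S.rank + T.rank + 2 ≤ n := by
  have huS : ∀ s b, ∑ c, u c s * S c b = 0 := by
    intro s b
    rw [← hSu s b]
    refine Finset.sum_congr rfl fun c _ => ?_
    rw [mul_comm, ← congrFun (congrFun hsymm c) b, Matrix.transpose_apply]
  have hTS : T * S = 0 := by
    -- Leibniz rule [Z, TS] = [Z, T]S + T[Z, S]: both terms vanish, by uᵀS = 0 and Tv = 0. Hence TS
    -- is diagonal.
    have hoff : ∀ a b, (σ a - σ b) * (T * S) a b = 0 := by
      intro a b
      have : (σ a - σ b) * (T * S) a b =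
          u a 0 * ∑ c, u c 1 * S c b - u a 1 * ∑ c, u c 0 * S c b +
          ((∑ c, T a c * v c 1) * v b 0 - (∑ c, T a c * v c 0) * v b 1) := by
        rw [Matrix.mul_apply, Finset.mul_sum, Finset.mul_sum, Finset.mul_sum, Finset.sum_mul,
          Finset.sum_mul, ← Finset.sum_sub_distrib, ← Finset.sum_sub_distrib,
          ← Finset.sum_add_distrib]
        refine Finset.sum_congr rfl fun c _ => ?_
        have h1 := hT a c
        have h2 := hS c b
        simp only [angle, square] at h1 h2
        linear_combination (S c b) * h1 + (T a c) * h2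
      rw [this, huS, huS, hTv, hTv]
      ring
    have hne : ∀ a b, a ≠ b → (T * S) a b = 0 := fun a b hab =>
      (mul_eq_zero.1 (hoff a b)).resolve_left (sub_ne_zero.2 (hσ.ne hab))
    ext a b
    by_cases hab : a = b
    · subst hab
      -- The diagonal matrix TS kills `u`, and no spinor `u a` is zero since its bracket with `p` is
      -- nonzero.
      have hann : ∀ s, (T * S) a a * u a s = 0 := by
        intro s
        have h0 : (T * S).mulVec (fun b => u b s) a = 0 := by
          rw [← Matrix.mulVec_mulVec, show S.mulVec (fun b => u b s) = 0 from funext (hSu s),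
            Matrix.mulVec_zero]
          rfl
        rw [← h0]
        change _ = ∑ b, (T * S) a b * u b s
        symm
        refine Finset.sum_eq_single a (fun b _ hb => ?_) fun h => absurd (Finset.mem_univ a) h
        rw [hne a b hb.symm, zero_mul]
      by_contra hc
      refine hp a ?_
      simp only [angle, (mul_eq_zero.1 (hann 0)).resolve_left hc,
        (mul_eq_zero.1 (hann 1)).resolve_left hc, zero_mul, sub_zero]
    · exact hne a b hab
  -- T Z v = Z T v - [Z, T] v, where the last term vanishes by momentum conservation.
  have hTZv : ∀ s a, ∑ b, T a b * (σ b * v b s) = 0 := by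
    intro s a
    have : ∑ b, T a b * (σ b * v b s) = σ a * ∑ b, T a b * v b s -
        (u a 0 * ∑ b, u b 1 * v b s - u a 1 * ∑ b, u b 0 * v b s) := by
      rw [Finset.mul_sum, Finset.mul_sum, Finset.mul_sum, ← Finset.sum_sub_distrib,
        ← Finset.sum_sub_distrib]
      refine Finset.sum_congr rfl fun b _ => ?_
      have h1 := hT a b
      simp only [angle] at h1
      linear_combination (-v b s) * h1
    rw [this, hTv, hmom, hmom]
    ring
  have hSZu : ∀ s a, ∑ b, S a b * (σ b * u b s) = 0 := by
    intro s a
    have : ∑ b, S a b * (σ b * u b s) = σ a * ∑ b, S a b * u b s -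
        (v a 1 * ∑ b, u b s * v b 0 - v a 0 * ∑ b, u b s * v b 1) := by
      rw [Finset.mul_sum, Finset.mul_sum, Finset.mul_sum, ← Finset.sum_sub_distrib,
        ← Finset.sum_sub_distrib]
      refine Finset.sum_congr rfl fun b _ => ?_
      have h1 := hS a b
      simp only [square] at h1
      linear_combination (-u b s) * h1
    rw [this, hSu, hmom, hmom]
    ring
  set U := LinearMap.range S.mulVecLin
  set V := Submodule.span ℂ (Set.range fun s : Fin 2 => fun a => v a s)
  set K := LinearMap.ker T.mulVecLin
  have hvL : ∀ s, (fun a => v a s) ∈ U ⊔ V := fun s =>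
    Submodule.mem_sup_right (Submodule.subset_span ⟨s, rfl⟩)
  have hUK : U ≤ K := by
    rintro _ ⟨x, rfl⟩
    rw [LinearMap.mem_ker, Matrix.mulVecLin_apply, Matrix.mulVecLin_apply, Matrix.mulVec_mulVec,
      hTS, Matrix.zero_mulVec]
  have hLK : U ⊔ V ≤ K := by
    refine sup_le hUK (Submodule.span_le.2 ?_)
    rintro _ ⟨s, rfl⟩
    exact funext (hTv s)
  -- Z S x = S Z x + [Z, S] x, and the image of the commutator lies in the span of the two
  -- components of `v`.
  have hZU : ∀ x ∈ U, (fun a => σ a * x a) ∈ U ⊔ V := by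
    rintro _ ⟨x, rfl⟩
    have : (fun a => σ a * S.mulVecLin x a) = S.mulVecLin (fun b => σ b * x b) +
        ((∑ b, v b 0 * x b) • (fun a => v a 1) - (∑ b, v b 1 * x b) • (fun a => v a 0)) := by
      ext a
      simp only [Matrix.mulVecLin_apply, Matrix.mulVec, dotProduct, Pi.add_apply, Pi.sub_apply,
        Pi.smul_apply, smul_eq_mul, Finset.mul_sum, Finset.sum_mul]
      rw [← Finset.sum_sub_distrib, ← Finset.sum_add_distrib]
      refine Finset.sum_congr rfl fun b _ => ?_
      have h1 := hS a b
      simp only [square] at h1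
      linear_combination (x b) * h1
    rw [this]
    exact Submodule.add_mem _ (Submodule.mem_sup_left ⟨_, rfl⟩)
      (Submodule.sub_mem _ (Submodule.smul_mem _ _ (hvL 1)) (Submodule.smul_mem _ _ (hvL 0)))
  have hZL : ∀ x ∈ U ⊔ V, (fun a => σ a * x a) ∈ K := by
    intro x hx
    obtain ⟨y, hy, z, hz, rfl⟩ := Submodule.mem_sup.1 hx
    have hzK : (fun a => σ a * z a) ∈ K := by
      clear hx
      induction hz using Submodule.span_induction with
      | mem z hz => obtain ⟨s, rfl⟩ := hz; exact funext (hTZv s)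
      | zero => simp only [Pi.zero_apply, mul_zero]; exact K.zero_mem
      | add z w _ _ hz hw =>
        convert K.add_mem hz hw using 1
        ext a; simp [mul_add]
      | smul c z _ hz =>
        convert K.smul_mem c hz using 1
        ext a; simp [mul_left_comm]
    convert K.add_mem (hLK (hZU y hy)) hzK using 1
    ext a; simp [mul_add]
  have hyL : (fun a => square (v a) q) ∈ U ⊔ V := by
    convert Submodule.sub_mem _ (Submodule.smul_mem _ (q 0) (hvL 1))
      (Submodule.smul_mem _ (q 1) (hvL 0)) using 1
    ext a
    simp only [square, Pi.sub_apply, Pi.smul_apply, smul_eq_mul]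
    ring
  have hrT := T.mulVecLin.finrank_range_add_finrank_ker
  have hrS := S.mulVecLin.finrank_range_add_finrank_ker
  rw [Module.finrank_fintype_fun_eq_card, Fintype.card_fin] at hrT hrS
  -- Equality would make U invariant and contain the nowhere-zero vector [v q], so S would be
  -- invertible, contradicting Su = 0.
  have hUL : U < U ⊔ V := by
    refine lt_of_le_of_ne le_sup_left fun h => ?_
    rw [← h] at hyL hZU
    have htop := eq_top_of_diagonal_invariant hσ U hZU hyL hq
    have hS0 : LinearMap.ker S.mulVecLin = ⊥ :=
      LinearMap.ker_eq_bot.2 (LinearMap.injective_iff_surjective.2 (LinearMap.range_eq_top.1 htop))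
    have hu0 : ∀ s, (fun b => u b s) = 0 := fun s =>
      LinearMap.ker_eq_bot'.1 hS0 _ (funext (hSu s))
    refine hp 0 ?_
    have h0 := congrFun (hu0 0) 0
    have h1 := congrFun (hu0 1) 0
    simp only [Pi.zero_apply] at h0 h1
    simp [angle, h0, h1]
  by_cases hLK' : U ⊔ V = K
  · have htop := eq_top_of_diagonal_invariant hσ (U ⊔ V) (fun x hx => hLK' ▸ hZL x hx) hyL hq
    have hT0 : Module.finrank ℂ (LinearMap.ker T.mulVecLin) = n := by
      change Module.finrank ℂ K = n
      rw [← hLK', htop, finrank_top]; simp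
    have hpair : LinearIndependent ℂ
        ![fun a => angle (u a) p, fun a => σ a * angle (u a) p] := by
      -- A single particle is impossible: contracted with `p` and `q`, momentum conservation would
      -- be one nonzero term.
      obtain ⟨b, hb⟩ : ∃ b : Fin n, b ≠ 0 := by
        by_contra! hall
        have hm : ∑ a, angle (u a) p * square (v a) q = 0 := by
          have : ∑ a, angle (u a) p * square (v a) q =
              p 1 * q 0 * ∑ a, u a 0 * v a 1 - p 1 * q 1 * ∑ a, u a 0 * v a 0 -
              (p 0 * q 0 * ∑ a, u a 1 * v a 1 - p 0 * q 1 * ∑ a, u a 1 * v a 0) := by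
            simp only [Finset.mul_sum, ← Finset.sum_sub_distrib]
            refine Finset.sum_congr rfl fun a _ => ?_
            simp only [angle, square]
            ring
          rw [this, hmom, hmom, hmom, hmom]
          ring
        rw [Finset.sum_eq_single 0 (fun a _ ha => absurd (hall a) ha) (by simp)] at hm
        exact mul_ne_zero (hp 0) (hq 0) hm
      rw [LinearIndependent.pair_iff]
      intro s t hst
      have h : ∀ a, s + t * σ a = 0 := by
        intro a
        have := congrFun hst a
        simp only [Pi.add_apply, Pi.smul_apply, smul_eq_mul, Pi.zero_apply] at this
        refine (mul_eq_zero.1 (?_ : (s + t * σ a) * angle (u a) p = 0)).resolve_right (hp a)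
        linear_combination this
      have ht : t = 0 := by
        refine (mul_eq_zero.1 (?_ : t * (σ b - σ 0) = 0)).resolve_right
          (sub_ne_zero.2 (hσ.ne hb))
        linear_combination h b - h 0
      exact ⟨by simpa [ht] using h 0, ht⟩
    have hle : Submodule.span ℂ (Set.range
        ![fun a => angle (u a) p, fun a => σ a * angle (u a) p]) ≤
        LinearMap.ker S.mulVecLin := by
      rw [Submodule.span_le]
      rintro _ ⟨s, rfl⟩
      have hk : ∀ f : Fin n → ℂ, (∀ s a, ∑ b, S a b * (f b * u b s) = 0) →
          (fun b => f b * angle (u b) p) ∈ LinearMap.ker S.mulVecLin := by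
        intro f hf
        refine funext fun a => ?_
        have : ∑ b, S a b * (f b * angle (u b) p) = p 1 * ∑ b, S a b * (f b * u b 0) -
            p 0 * ∑ b, S a b * (f b * u b 1) := by
          rw [Finset.mul_sum, Finset.mul_sum, ← Finset.sum_sub_distrib]
          refine Finset.sum_congr rfl fun b _ => ?_
          simp only [angle]
          ring
        change ∑ b, S a b * (f b * angle (u b) p) = 0
        rw [this, hf, hf]
        ring
      fin_cases s
      · simpa using hk (fun _ => 1) (by simpa using hSu)
      · exact hk σ hSZu
    have h2 := Submodule.finrank_mono hle
    rw [finrank_span_eq_card hpair, Fintype.card_fin] at h2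
    unfold Matrix.rank
    omega
  · have h1 := Submodule.finrank_lt_finrank_of_lt hUL
    have h2 := Submodule.finrank_lt_finrank_of_lt (lt_of_le_of_ne hLK hLK')
    change Module.finrank ℂ U + Module.finrank ℂ (LinearMap.range T.mulVecLin) + 2 ≤ n
    change _ + Module.finrank ℂ K = n at hrT
    omega

/-! ### Kinematics and the discriminant matrices -/

section Kinematics

variable {n : ℕ} {lam lamT : Fin n → Spinor} {p q : Spinor} {σ : Fin n → ℂ}

theorem mandelstam_eq (lam lamT : Fin n → Spinor) (a b : Fin n) :
    mandelstam lam lamT a b = -(angle (lam a) (lam b) * square (lamT a) (lamT b)) := by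
  have : mdot (momentum lam lamT a) (momentum lam lamT b) =
      1 / 4 * mdot (sandwich (lam a) (lamT a)) (sandwich (lam b) (lamT b)) := by
    simp only [momentum, mdot, Pi.smul_apply, smul_eq_mul]
    ring
  rw [mandelstam, this, mdot_sandwich]
  simp only [square]
  ring

/-- The matrices in `pauli` form a basis of the 2 × 2 matrices, so the four components of total
momentum determine all four spinor sums. -/
theorem sum_mul_eq_zero_of_momentum (hmom : ∑ a, momentum lam lamT a = 0) (s t : Fin 2) :
    ∑ a, lam a s * lamT a t = 0 := by
  have h : ∀ μ, ∑ a, sandwich (lam a) (lamT a) μ = 0 := by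
    intro μ
    have := congrFun hmom μ
    simp only [Finset.sum_apply, momentum, Pi.smul_apply, smul_eq_mul, ← Finset.mul_sum] at this
    simpa using this
  have h0 : (∑ a, lam a 0 * lamT a 0) + ∑ a, lam a 1 * lamT a 1 = 0 := by
    rw [← h 0, ← Finset.sum_add_distrib]
    exact Finset.sum_congr rfl fun a _ => by
      simp [sandwich, pauli, dotProduct, Matrix.mulVec, Fin.sum_univ_two, Matrix.one_apply]
  have h1 : (∑ a, lam a 0 * lamT a 1) + ∑ a, lam a 1 * lamT a 0 = 0 := by
    rw [← h 1, ← Finset.sum_add_distrib]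
    exact Finset.sum_congr rfl fun a _ => by
      simp [sandwich, pauli, dotProduct, Matrix.mulVec, Fin.sum_univ_two]
  have h2 : -Complex.I * (∑ a, lam a 0 * lamT a 1) + Complex.I * ∑ a, lam a 1 * lamT a 0 = 0 := by
    rw [← h 2, Finset.mul_sum, Finset.mul_sum, ← Finset.sum_add_distrib]
    exact Finset.sum_congr rfl fun a _ => by
      simp [sandwich, pauli, dotProduct, Matrix.mulVec, Fin.sum_univ_two]
      ring
  have h3 : (∑ a, lam a 0 * lamT a 0) - ∑ a, lam a 1 * lamT a 1 = 0 := by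
    rw [← h 3, ← Finset.sum_sub_distrib]
    exact Finset.sum_congr rfl fun a _ => by
      simp [sandwich, pauli, dotProduct, Matrix.mulVec, Fin.sum_univ_two]
      ring
  have h2' : (∑ a, lam a 1 * lamT a 0) - ∑ a, lam a 0 * lamT a 1 = 0 := by
    linear_combination (-Complex.I) * h2 +
      ((∑ a, lam a 1 * lamT a 0) - ∑ a, lam a 0 * lamT a 1) * Complex.I_mul_I
  fin_cases s <;> fin_cases t <;> simp only [Fin.zero_eta, Fin.mk_one, Fin.isValue]
  · linear_combination (h0 + h3) / 2
  · linear_combination (h1 - h2') / 2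
  · linear_combination (h1 + h2') / 2
  · linear_combination (h0 - h3) / 2

theorem discMinus_commutator (lam lamT : Fin n → Spinor) (q : Spinor)
    (hσ : Function.Injective σ) (a b : Fin n) :
    (σ a - σ b) * discMinus lam lamT q σ a b = angle (lam a) (lam b) := by
  by_cases h : a = b
  · subst h; simp [angle]; ring
  · have := sub_ne_zero.2 (hσ.ne h)
    simp only [discMinus, Matrix.of_apply, if_neg h]
    field_simp

theorem discPlus_commutator (lam lamT : Fin n → Spinor) (p : Spinor)
    (hσ : Function.Injective σ) (a b : Fin n) :
    (σ a - σ b) * discPlus lam lamT p σ a b = square (lamT a) (lamT b) := by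
  by_cases h : a = b
  · subst h; simp [square]; ring
  · have := sub_ne_zero.2 (hσ.ne h)
    simp only [discPlus, Matrix.of_apply, if_neg h]
    field_simp

theorem discMinus_transpose (lam lamT : Fin n → Spinor) (q : Spinor) (σ : Fin n → ℂ) :
    (discMinus lam lamT q σ).transpose = discMinus lam lamT q σ := by
  ext a b
  by_cases h : a = b
  · subst h; rfl
  · rw [Matrix.transpose_apply]
    simp only [discMinus, Matrix.of_apply, if_neg h, if_neg (Ne.symm h)]
    rw [← neg_sub (σ a), ← neg_div_neg_eq, neg_neg]
    simp only [angle]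
    congr 1
    ring

theorem discPlus_transpose (lam lamT : Fin n → Spinor) (p : Spinor) (σ : Fin n → ℂ) :
    (discPlus lam lamT p σ).transpose = discPlus lam lamT p σ := by
  ext a b
  by_cases h : a = b
  · subst h; rfl
  · rw [Matrix.transpose_apply]
    simp only [discPlus, Matrix.of_apply, if_neg h, if_neg (Ne.symm h)]
    rw [← neg_sub (σ a), ← neg_div_neg_eq, neg_neg]
    simp only [square]
    congr 1
    ring

/-- Solving for a spinor from its brackets with two independent spinors. -/
theorem eq_zero_of_angle_eq_zero {w x y : Spinor} (hxy : angle x y ≠ 0) (hx : angle w x = 0)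
    (hy : angle w y = 0) : w = 0 := by
  simp only [angle] at *
  ext s
  refine (mul_eq_zero.1 (?_ : (x 0 * y 1 - x 1 * y 0) * w s = 0)).resolve_left hxy
  fin_cases s <;> simp only [Fin.zero_eta, Fin.mk_one, Fin.isValue]
  · linear_combination (x 0) * hy - (y 0) * hx
  · linear_combination (x 1) * hy - (y 1) * hx

theorem square_eq (x y : Spinor) : square x y = -angle x y := by
  simp only [square, angle]
  ring

/-- The spinor in question is tested against two independent spinors: its bracket with `lamT a` is a
scattering equation up to sign, and its bracket with `q` vanishes by the choice of diagonal entry.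
-/
theorem sum_discMinus_mul (hq : ∀ a, square (lamT a) q ≠ 0) (hsol : IsSolution lam lamT σ)
    (s : Fin 2) (a : Fin n) : ∑ b, discMinus lam lamT q σ a b * lamT b s = 0 := by
  have hlin : ∀ z, angle (fun s => ∑ b, discMinus lam lamT q σ a b * lamT b s) z =
      ∑ b, discMinus lam lamT q σ a b * angle (lamT b) z := by
    intro z
    simp only [angle, Finset.sum_mul, ← Finset.sum_sub_distrib]
    exact Finset.sum_congr rfl fun _ _ => by ring
  have haq : angle (lamT a) q ≠ 0 := by have := hq a; rwa [square_eq, neg_ne_zero] at this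
  refine congrFun (eq_zero_of_angle_eq_zero (w := fun s => ∑ b, discMinus lam lamT q σ a b *
    lamT b s) haq ?_ ?_) s
  · rw [hlin, ← Finset.add_sum_erase _ _ (Finset.mem_univ a),
      show angle (lamT a) (lamT a) = 0 by simp only [angle]; ring, mul_zero, zero_add,
      ← neg_eq_zero, ← hsol.2 a, ← Finset.sum_neg_distrib]
    refine Finset.sum_congr rfl fun b hb => ?_
    simp only [discMinus, Matrix.of_apply, if_neg (Finset.ne_of_mem_erase hb).symm,
      mandelstam_eq, angle, square]
    ring
  · rw [hlin, ← Finset.add_sum_erase _ _ (Finset.mem_univ a)]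
    simp only [discMinus, Matrix.of_apply, if_true]
    rw [neg_mul, Finset.sum_mul, neg_add_eq_zero]
    refine Finset.sum_congr rfl fun b hb => ?_
    have hab := sub_ne_zero.2 (hsol.1.ne (Finset.ne_of_mem_erase hb).symm)
    rw [if_neg (Finset.ne_of_mem_erase hb).symm]
    simp only [square_eq]
    field_simp

theorem sum_discPlus_mul (hp : ∀ a, angle (lam a) p ≠ 0) (hsol : IsSolution lam lamT σ)
    (s : Fin 2) (a : Fin n) : ∑ b, discPlus lam lamT p σ a b * lam b s = 0 := by
  have hlin : ∀ z, angle (fun s => ∑ b, discPlus lam lamT p σ a b * lam b s) z =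
      ∑ b, discPlus lam lamT p σ a b * angle (lam b) z := by
    intro z
    simp only [angle, Finset.sum_mul, ← Finset.sum_sub_distrib]
    exact Finset.sum_congr rfl fun _ _ => by ring
  have hap := hp a
  refine congrFun (eq_zero_of_angle_eq_zero (w := fun s => ∑ b, discPlus lam lamT p σ a b *
    lam b s) hap ?_ ?_) s
  · rw [hlin, ← Finset.add_sum_erase _ _ (Finset.mem_univ a),
      show angle (lam a) (lam a) = 0 by simp only [angle]; ring, mul_zero, zero_add, ← hsol.2 a]
    refine Finset.sum_congr rfl fun b hb => ?_
    simp only [discPlus, Matrix.of_apply, if_neg (Finset.ne_of_mem_erase hb).symm,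
      mandelstam_eq, angle, square]
    ring
  · rw [hlin, ← Finset.add_sum_erase _ _ (Finset.mem_univ a)]
    simp only [discPlus, Matrix.of_apply, if_true]
    rw [neg_mul, Finset.sum_mul, neg_add_eq_zero]
    refine Finset.sum_congr rfl fun b hb => ?_
    have hab := sub_ne_zero.2 (hsol.1.ne (Finset.ne_of_mem_erase hb).symm)
    rw [if_neg (Finset.ne_of_mem_erase hb).symm]
    field_simp

theorem rank_discPlus_add_rank_discMinus [NeZero n] (hmom : ∑ a, momentum lam lamT a = 0)
    (hp : ∀ a, angle (lam a) p ≠ 0) (hq : ∀ a, square (lamT a) q ≠ 0)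
    (hsol : IsSolution lam lamT σ) :
    (discPlus lam lamT p σ).rank + (discMinus lam lamT q σ).rank + 2 ≤ n :=
  rank_add_rank_add_two_le hsol.1 _ _ (discPlus_transpose lam lamT p σ) lam lamT
    (discPlus_commutator lam lamT p hsol.1) (discMinus_commutator lam lamT q hsol.1)
    (sum_discPlus_mul hp hsol) (sum_discMinus_mul hq hsol)
    (sum_mul_eq_zero_of_momentum hmom) hp hq

theorem one_le_rank {M : Matrix (Fin n) (Fin n) ℂ} {a b : Fin n} (h : M a b ≠ 0) : 1 ≤ M.rank := by
  rw [Nat.one_le_iff_ne_zero]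
  intro h0
  have hM : M.mulVecLin = 0 :=
    LinearMap.range_eq_bot.1 (Submodule.finrank_eq_zero.1 h0)
  have := congrFun (LinearMap.congr_fun hM (Pi.single b 1)) a
  rw [Matrix.mulVecLin_apply, Matrix.mulVec_single_one] at this
  exact h this

theorem one_le_rank_discMinus (lamT : Fin n → Spinor) (q : Spinor) (hσ : Function.Injective σ)
    {a b : Fin n} (h : angle (lam a) (lam b) ≠ 0) : 1 ≤ (discMinus lam lamT q σ).rank :=
  one_le_rank (right_ne_zero_of_mul (discMinus_commutator lam lamT q hσ a b ▸ h))

theorem one_le_rank_discPlus (lam : Fin n → Spinor) (p : Spinor) (hσ : Function.Injective σ)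
    {a b : Fin n} (h : square (lamT a) (lamT b) ≠ 0) : 1 ≤ (discPlus lam lamT p σ).rank :=
  one_le_rank (right_ne_zero_of_mul (discPlus_commutator lam lamT p hσ a b ▸ h))

/-! ### Polarizations and the blocks of Ψ -/

theorem mdot_comm (x y : FourVec) : mdot x y = mdot y x := by
  simp only [mdot]
  ring

theorem mdot_smul_left (c : ℂ) (x y : FourVec) : mdot (c • x) y = c * mdot x y := by
  simp only [mdot, Pi.smul_apply, smul_eq_mul]
  ring

theorem mdot_smul_right (c : ℂ) (x y : FourVec) : mdot x (c • y) = c * mdot x y := by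
  rw [mdot_comm, mdot_smul_left, mdot_comm]

/-- All negative polarizations share the reference spinor `q`, so the Fierz identity produces the
factor [qq] = 0. -/
theorem mdot_polarization_of_mem (neg : Finset (Fin n)) {a b : Fin n} (ha : a ∈ neg)
    (hb : b ∈ neg) :
    mdot (polarization lam lamT p q neg a) (polarization lam lamT p q neg b) = 0 := by
  simp only [polarization, if_pos ha, if_pos hb, mdot_smul_left, mdot_smul_right, mdot_sandwich]
  simp only [square]
  ring

theorem mdot_polarization_of_notMem (neg : Finset (Fin n)) {a b : Fin n} (ha : a ∉ neg)
    (hb : b ∉ neg) :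
    mdot (polarization lam lamT p q neg a) (polarization lam lamT p q neg b) = 0 := by
  simp only [polarization, if_neg ha, if_neg hb, mdot_smul_left, mdot_smul_right, mdot_sandwich]
  simp only [angle]
  ring

theorem sqrt_two_ne_zero : (Real.sqrt 2 : ℂ) ≠ 0 := by
  exact_mod_cast (Real.sqrt_pos.2 (by norm_num : (0 : ℝ) < 2)).ne'

theorem sqrt_two_mul_mdot_of_mem (hq : ∀ a, square (lamT a) q ≠ 0) (neg : Finset (Fin n))
    {a : Fin n} (ha : a ∈ neg) (b : Fin n) :
    (Real.sqrt 2 : ℂ) * mdot (polarization lam lamT p q neg a) (momentum lam lamT b) =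
      -(angle (lam a) (lam b) * square (lamT b) q / square (lamT a) q) := by
  simp only [polarization, if_pos ha, momentum, mdot_smul_left, mdot_smul_right, mdot_sandwich]
  have h := hq a
  have h2 := sqrt_two_ne_zero
  rw [show square q (lamT a) = -square (lamT a) q by simp only [square]; ring]
  field_simp

theorem sqrt_two_mul_mdot_of_notMem (hp : ∀ a, angle (lam a) p ≠ 0) (neg : Finset (Fin n))
    {a : Fin n} (ha : a ∉ neg) (b : Fin n) :
    (Real.sqrt 2 : ℂ) * mdot (polarization lam lamT p q neg a) (momentum lam lamT b) =
      -(square (lamT a) (lamT b) * angle (lam b) p / angle (lam a) p) := by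
  simp only [polarization, if_neg ha, momentum, mdot_smul_left, mdot_smul_right, mdot_sandwich]
  have h := hp a
  have h2 := sqrt_two_ne_zero
  rw [show angle p (lam a) = -angle (lam a) p by simp only [angle]; ring,
    show angle p (lam b) = -angle (lam b) p by simp only [angle]; ring,
    show square (lamT b) (lamT a) = -square (lamT a) (lamT b) by simp only [square]; ring]
  field_simp

theorem blockC_of_mem (hq : ∀ a, square (lamT a) q ≠ 0) (neg : Finset (Fin n))
    {a : Fin n} (ha : a ∈ neg) (b : Fin n) :
    blockC lam lamT p q neg σ a b =
      (square (lamT a) q)⁻¹ * (discMinus lam lamT q σ a b * square (lamT b) q) := by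
  have h := hq a
  by_cases hab : a = b
  · subst hab
    simp only [blockC, discMinus, Matrix.of_apply, if_true, sqrt_two_mul_mdot_of_mem hq neg ha]
    rw [mul_comm (-_), inv_mul_cancel_left₀ h, ← Finset.sum_neg_distrib]
    refine Finset.sum_congr rfl fun c _ => ?_
    rw [neg_div, div_div, mul_comm (square (lamT a) q)]
  · simp only [blockC, discMinus, Matrix.of_apply, if_neg hab, sqrt_two_mul_mdot_of_mem hq neg ha]
    ring

theorem blockC_of_notMem (hp : ∀ a, angle (lam a) p ≠ 0) (neg : Finset (Fin n))
    {a : Fin n} (ha : a ∉ neg) (b : Fin n) :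
    blockC lam lamT p q neg σ a b =
      (angle (lam a) p)⁻¹ * (discPlus lam lamT p σ a b * angle (lam b) p) := by
  have h := hp a
  by_cases hab : a = b
  · subst hab
    simp only [blockC, discPlus, Matrix.of_apply, if_true, sqrt_two_mul_mdot_of_notMem hp neg ha]
    rw [mul_comm (-_), inv_mul_cancel_left₀ h, ← Finset.sum_neg_distrib]
    refine Finset.sum_congr rfl fun c _ => ?_
    rw [neg_div, div_div, mul_comm (angle (lam a) p)]
  · simp only [blockC, discPlus, Matrix.of_apply, if_neg hab,
      sqrt_two_mul_mdot_of_notMem hp neg ha]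
    ring

theorem blockA_transpose (lam lamT : Fin n → Spinor) (σ : Fin n → ℂ) :
    (blockA lam lamT σ).transpose = -blockA lam lamT σ := by
  ext a b
  by_cases h : a = b
  · subst h; simp [blockA]
  · simp only [blockA, Matrix.transpose_apply, Matrix.neg_apply, Matrix.of_apply, if_neg h,
      if_neg (Ne.symm h), mandelstam]
    rw [mdot_comm, ← neg_sub (σ a), div_neg]

theorem blockB_transpose (neg : Finset (Fin n)) :
    (blockB lam lamT p q neg σ).transpose = -blockB lam lamT p q neg σ := by
  ext a b
  by_cases h : a = b
  · subst h; simp [blockB]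
  · simp only [blockB, Matrix.transpose_apply, Matrix.neg_apply, Matrix.of_apply, if_neg h,
      if_neg (Ne.symm h)]
    rw [mdot_comm, ← neg_sub (σ a), div_neg]

/-! ### Helicity counts against ranks -/

/-- The isotropy bound applies with D = [aq] and H = [ia]. Any auxiliary spinor independent of `q`
could replace `lamT i` in the Schouten identity that splits [ab]. -/
theorem card_neg_le (hq : ∀ a, square (lamT a) q ≠ 0)
    {neg : Finset (Fin n)} {i j : Fin n} (hij : i ≠ j)
    (hpf : reducedPf lam lamT p q neg σ i j ≠ 0) :
    neg.card ≤ (discMinus lam lamT q σ).rank + 1 := by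
  refine card_le_rank_add_one_of_pfaffianOn_ne_zero (blockA lam lamT σ)
    (blockB lam lamT p q neg σ) (blockC lam lamT p q neg σ) _ (blockA_transpose lam lamT σ)
    (blockB_transpose neg) (discMinus_transpose lam lamT q σ) (-(square (lamT i) q)⁻¹)
    (fun a => square (lamT a) q) (fun a => square (lamT i) (lamT a)) (fun a => (square (lamT a) q)⁻¹)
    neg (fun a b => ?_) (fun a ha b => blockC_of_mem hq neg ha b) (fun a ha b hb => ?_) hij
    (right_ne_zero_of_mul hpf)
  · by_cases hab : a = b
    · subst hab
      simp only [blockA, Matrix.of_apply, if_true]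
      ring
    · have schouten : square (lamT a) (lamT b) * square (lamT i) q =
          square (lamT a) q * square (lamT i) (lamT b) -
            square (lamT i) (lamT a) * square (lamT b) q := by
        simp only [square]
        ring
      have hi := hq i
      have : square (lamT a) (lamT b) = (square (lamT i) q)⁻¹ *
          (square (lamT a) q * square (lamT i) (lamT b) -
            square (lamT i) (lamT a) * square (lamT b) q) := by
        rw [← schouten]
        field_simp
      simp only [blockA, discMinus, Matrix.of_apply, if_neg hab, mandelstam_eq]
      rw [this]
      ring
  · simp only [blockB, Matrix.of_apply, mdot_polarization_of_mem neg ha hb, zero_div, ite_self]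

theorem card_compl_neg_le (hp : ∀ a, angle (lam a) p ≠ 0)
    {neg : Finset (Fin n)} {i j : Fin n} (hij : i ≠ j)
    (hpf : reducedPf lam lamT p q neg σ i j ≠ 0) :
    negᶜ.card ≤ (discPlus lam lamT p σ).rank + 1 := by
  refine card_le_rank_add_one_of_pfaffianOn_ne_zero (blockA lam lamT σ)
    (blockB lam lamT p q neg σ) (blockC lam lamT p q neg σ) _ (blockA_transpose lam lamT σ)
    (blockB_transpose neg) (discPlus_transpose lam lamT p σ) (-(angle (lam i) p)⁻¹)
    (fun a => angle (lam a) p) (fun a => angle (lam i) (lam a)) (fun a => (angle (lam a) p)⁻¹)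
    negᶜ (fun a b => ?_)
    (fun a ha b => blockC_of_notMem hp neg (Finset.mem_compl.1 ha) b) (fun a ha b hb => ?_) hij
    (right_ne_zero_of_mul hpf)
  · by_cases hab : a = b
    · subst hab
      simp only [blockA, Matrix.of_apply, if_true]
      ring
    · have schouten : angle (lam a) (lam b) * angle (lam i) p =
          angle (lam a) p * angle (lam i) (lam b) -
            angle (lam i) (lam a) * angle (lam b) p := by
        simp only [angle]
        ring
      have hi := hp i
      have : angle (lam a) (lam b) = (angle (lam i) p)⁻¹ *
          (angle (lam a) p * angle (lam i) (lam b) -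
            angle (lam i) (lam a) * angle (lam b) p) := by
        rw [← schouten]
        field_simp
      simp only [blockA, discPlus, Matrix.of_apply, if_neg hab, mandelstam_eq]
      rw [this]
      ring
  · simp only [blockB, Matrix.of_apply, mdot_polarization_of_notMem neg (Finset.mem_compl.1 ha)
      (Finset.mem_compl.1 hb), zero_div, ite_self]

/-- The chain n = #neg + #pos ≤ r₋ + r₊ + 2 ≤ n collapses, so each helicity count equals the
corresponding rank plus one. -/
theorem rank_eq_of_reducedPf_ne_zero (hmom : ∑ a, momentum lam lamT a = 0)
    (hp : ∀ a, angle (lam a) p ≠ 0) (hq : ∀ a, square (lamT a) q ≠ 0)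
    (hsol : IsSolution lam lamT σ) {neg : Finset (Fin n)} {i j : Fin n} (hij : i ≠ j)
    (hpf : reducedPf lam lamT p q neg σ i j ≠ 0) :
    (discMinus lam lamT q σ).rank + 1 = neg.card ∧
      (discPlus lam lamT p σ).rank + 1 + neg.card = n := by
  have : NeZero n := ⟨i.pos.ne'⟩
  have h1 := card_neg_le hq hij hpf
  have h2 := card_compl_neg_le hp hij hpf
  have h3 := rank_discPlus_add_rank_discMinus hmom hp hq hsol
  have h4 := Finset.card_add_card_compl neg
  rw [Fintype.card_fin] at h4
  omega

end Kinematics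

end CHY

/-! ### Partition of the solutions and support of the integrands -/

theorem theorem1 {n : ℕ} (lam lamT : Fin n → CHY.Spinor) (p q : CHY.Spinor)
    (hmom : ∑ a, CHY.momentum lam lamT a = 0)
    (hp : ∀ a, CHY.angle (lam a) p ≠ 0) (hq : ∀ a, CHY.square (lamT a) q ≠ 0) :
    -- the ranks of the discriminant matrices partition the solution set
    ((∃ a b, CHY.angle (lam a) (lam b) ≠ 0) → (∃ a b, CHY.square (lamT a) (lamT b) ≠ 0) →
      {σ | CHY.IsSolution lam lamT σ} =
          ⋃ m ∈ Set.Icc (0 : ℤ) ((n : ℤ) - 4), CHY.PMinus lam lamT q m ∧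
      {σ | CHY.IsSolution lam lamT σ} =
          ⋃ m ∈ Set.Icc (0 : ℤ) ((n : ℤ) - 4), CHY.PPlus lam lamT p m) ∧
    Pairwise (fun m m' : ℤ => Disjoint (CHY.PMinus lam lamT q m) (CHY.PMinus lam lamT q m')) ∧
    Pairwise (fun m m' : ℤ => Disjoint (CHY.PPlus lam lamT p m) (CHY.PPlus lam lamT p m')) ∧
    -- support of the reduced Pfaffian and of the integrands
    ∀ σ : Fin n → ℂ, CHY.IsSolution lam lamT σ →
    ∀ (neg : Finset (Fin n)) (k : ℤ) (i j : Fin n), i < j →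
      -- N^k MHV and the classes of the first kind
      (CHY.IsNkMHV neg k →
        (CHY.reducedPf lam lamT p q neg σ i j ≠ 0 → σ ∈ CHY.PMinus lam lamT q k) ∧
        (CHY.integrandYM lam lamT p q neg σ i j ≠ 0 → σ ∈ CHY.PMinus lam lamT q k) ∧
        (CHY.integrandGravity lam lamT p q neg σ i j ≠ 0 → σ ∈ CHY.PMinus lam lamT q k) ∧
        (∀ (r : ℕ) (g : Fin r ↪ Fin n), CHY.integrandEYM lam lamT p q neg σ g i j ≠ 0 →
          σ ∈ CHY.PMinus lam lamT q k)) ∧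
      -- N^(n-k-4) MHV and the classes of the second kind
      (CHY.IsNkMHV neg ((n : ℤ) - k - 4) →
        (CHY.reducedPf lam lamT p q neg σ i j ≠ 0 → σ ∈ CHY.PPlus lam lamT p k) ∧
        (CHY.integrandYM lam lamT p q neg σ i j ≠ 0 → σ ∈ CHY.PPlus lam lamT p k) ∧
        (CHY.integrandGravity lam lamT p q neg σ i j ≠ 0 → σ ∈ CHY.PPlus lam lamT p k) ∧
        (∀ (r : ℕ) (g : Fin r ↪ Fin n), CHY.integrandEYM lam lamT p q neg σ g i j ≠ 0 →
          σ ∈ CHY.PPlus lam lamT p k)) := by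
  have hrank : ∀ σ, CHY.IsSolution lam lamT σ → (∃ a b, CHY.angle (lam a) (lam b) ≠ 0) →
      (∃ a b, CHY.square (lamT a) (lamT b) ≠ 0) →
      1 ≤ (CHY.discMinus lam lamT q σ).rank ∧ 1 ≤ (CHY.discPlus lam lamT p σ).rank ∧
      (CHY.discPlus lam lamT p σ).rank + (CHY.discMinus lam lamT q σ).rank + 2 ≤ n := by
    rintro σ hsol ⟨a, b, hab⟩ ⟨c, d, hcd⟩
    have : NeZero n := ⟨a.pos.ne'⟩
    exact ⟨CHY.one_le_rank_discMinus lamT q hsol.1 hab, CHY.one_le_rank_discPlus lam p hsol.1 hcd,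
      CHY.rank_discPlus_add_rank_discMinus hmom hp hq hsol⟩
  refine ⟨fun hang hsq => ⟨?_, ?_⟩, ?_, ?_, ?_⟩
  · ext σ
    simp only [Set.mem_ofPred_eq, Set.mem_iUnion, exists_prop, CHY.PMinus, Set.mem_Icc]
    refine ⟨fun hsol => ?_, fun ⟨_, _, hsol, _⟩ => hsol⟩
    obtain ⟨h1, h2, h3⟩ := hrank σ hsol hang hsq
    -- The witness is an integer difference. The bound m ≤ n - 4 uses that the other rank is at
    -- least one: r₋ ≤ n - 2 - r₊ ≤ n - 3.
    exact ⟨(CHY.discMinus lam lamT q σ).rank - 1, by omega, hsol, by omega⟩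
  · ext σ
    simp only [Set.mem_ofPred_eq, Set.mem_iUnion, exists_prop, CHY.PPlus, Set.mem_Icc]
    refine ⟨fun hsol => ?_, fun ⟨_, _, hsol, _⟩ => hsol⟩
    obtain ⟨h1, h2, h3⟩ := hrank σ hsol hang hsq
    exact ⟨(CHY.discPlus lam lamT p σ).rank - 1, by omega, hsol, by omega⟩
  · intro m m' hmm
    exact Set.disjoint_left.2 fun σ h h' => hmm (by have := h.2; have := h'.2; omega)
  · intro m m' hmm
    exact Set.disjoint_left.2 fun σ h h' => hmm (by have := h.2; have := h'.2; omega)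
  · intro σ hsol neg k i j hij
    have hYM : CHY.integrandYM lam lamT p q neg σ i j ≠ 0 →
        CHY.reducedPf lam lamT p q neg σ i j ≠ 0 := by
      intro h h0
      simp [CHY.integrandYM, h0] at h
    have hG : CHY.integrandGravity lam lamT p q neg σ i j ≠ 0 →
        CHY.reducedPf lam lamT p q neg σ i j ≠ 0 := by
      intro h h0
      simp [CHY.integrandGravity, h0] at h
    have hEYM : ∀ (r : ℕ) (g : Fin r ↪ Fin n),
        CHY.integrandEYM lam lamT p q neg σ g i j ≠ 0 →
          CHY.reducedPf lam lamT p q neg σ i j ≠ 0 := by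
      intro r g h h0
      simp [CHY.integrandEYM, h0] at h
    constructor
    · intro hk
      have key : CHY.reducedPf lam lamT p q neg σ i j ≠ 0 → σ ∈ CHY.PMinus lam lamT q k := by
        intro hpf
        have h := (CHY.rank_eq_of_reducedPf_ne_zero hmom hp hq hsol hij.ne hpf).1
        unfold CHY.IsNkMHV at hk
        exact ⟨hsol, by omega⟩
      exact ⟨key, key ∘ hYM, key ∘ hG, fun r g => key ∘ hEYM r g⟩
    · intro hk
      have key : CHY.reducedPf lam lamT p q neg σ i j ≠ 0 → σ ∈ CHY.PPlus lam lamT p k := by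
        intro hpf
        have h := (CHY.rank_eq_of_reducedPf_ne_zero hmom hp hq hsol hij.ne hpf).2
        unfold CHY.IsNkMHV at hk
        exact ⟨hsol, by omega⟩
      exact ⟨key, key ∘ hYM, key ∘ hG, fun r g => key ∘ hEYM r g⟩
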